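/- Say that a permutation $\sigma$ of $\{1,\dots,n\}$ \emph{avoids} a pattern $\tau\in S_k$ if no subsequence of $k$ entries $\sigma(i_1),\dots,\sigma(i_k)$ with $i_1<\dots<i_k$ is in the same relative order as $\tau$. For $n\ge 2$ let $\mathcal{S}_{n,1}^{1\prec n}(1243,1324)$ be the set of permutations $\sigma$ of $\{1,\dots,n\}$ that avoid both $1243$ and $1324$ and satisfy $\sigma^{-1}(n)-\sigma^{-1}(1)=1$ (the entry $1$ stands immediately to the left of the entry $n$). For $1\le\ell\le n-1$ let $t_{n,\ell}$ be the number of $\sigma\in\mathcal{S}_{n,1}^{1\prec n}(1243,1324)$ with $\sigma(1)=\ell$, and let $s_n=\sum_{\ell=1}^{n-1}t_{n,\ell}$. Then, as formal power series over $\mathbb{Q}$, the generating function \[ g(x,u)=\sum_{n=2}^{\infty}\sum_{\ell=1}^{n-1}t_{n,\ell}\,u^\ell x^n \] is given by \[ g(x,u)=\frac{1}{1-u-x}\left[\frac{u(1-u)\,x^2(1-x)^2}{1-2x}-\frac{u^3x^3}{\sqrt{1-4ux}}\right], \] where the square root is the one with constant term $1$. In particular (each coefficient of $x^n$ in $g(x,u)$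 is a polynomial in $u$, so that $u=1$ may be substituted), \[ g(x,1)=\frac{x^2}{\sqrt{1-4x}}=\sum_{n=2}^{\infty}\binom{2(n-2)}{n-2}x^n, \] and therefore $s_n=\left|\mathcal{S}_{n,1}^{1\prec n}(1243,1324)\right|=\binom{2(n-2)}{n-2}$ for every $n\ge 2$. -/

import Mathlib

open Polynomial PowerSeries

namespace PatternAvoid

/-- The permutation `σ` of size `n` contains the pattern `τ` of size `k`: some `k` positions
`f 0 < ⋯ < f (k-1)` carry entries of `σ` that are in the same relative order as the entries
of `τ`. Permutations of `{1, …, n}` are elements of `Equiv.Perm (Fin n)`; position `i` and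
entry `v` of the usual one-line notation correspond to `i - 1` and `v - 1` in `Fin n`. -/
def Contains {n k : ℕ} (σ : Equiv.Perm (Fin n)) (τ : Equiv.Perm (Fin k)) : Prop :=
  ∃ f : Fin k ↪o Fin n, ∀ i j : Fin k, σ (f i) < σ (f j) ↔ τ i < τ j

/-- The set of permutations of size `n` that avoid every pattern in `P`. -/
def avoiders (n : ℕ) {k : ℕ} (P : Set (Equiv.Perm (Fin k))) : Set (Equiv.Perm (Fin n)) :=
  {σ | ∀ τ ∈ P, ¬ Contains σ τ}

/-- The permutations of size `n` that avoid `P`, have the entry `a` to the left of the entry `n`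
at distance `d`, and have all entries less than `a` to the right of `n`
(entries in the usual convention `1, …, n`). -/
def avoidersDist (n d a : ℕ) {k : ℕ} (P : Set (Equiv.Perm (Fin k))) :
    Set (Equiv.Perm (Fin n)) :=
  {σ | σ ∈ avoiders n P ∧ ∃ p q : Fin n,
    (σ p : ℕ) + 1 = a ∧ (σ q : ℕ) + 1 = n ∧ (q : ℕ) = p + d ∧
    ∀ r : Fin n, (σ r : ℕ) + 1 < a → q < r}

/-- The pattern 1243. -/
def p1243 : Equiv.Perm (Fin 4) :=
  ⟨![0, 1, 3, 2], ![0, 1, 3, 2], by decide, by decide⟩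

/-- The pattern 1324. -/
def p1324 : Equiv.Perm (Fin 4) :=
  ⟨![0, 2, 1, 3], ![0, 2, 1, 3], by decide, by decide⟩

/-- The (1243,1324)-avoiders of size `n` with `1` immediately to the left of `n`. -/
def adjacentAvoiders (n : ℕ) : Set (Equiv.Perm (Fin n)) :=
  avoidersDist n 1 1 {p1243, p1324}

/-- `t n ℓ` counts the elements of `adjacentAvoiders n` whose first entry is `ℓ`. -/
noncomputable def t (n ℓ : ℕ) : ℕ :=
  {σ | σ ∈ adjacentAvoiders n ∧ ∃ i : Fin n, (i : ℕ) = 0 ∧ (σ i : ℕ) + 1 = ℓ}.ncard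

/-- The row polynomial `∑_{ℓ=1}^{n-1} t n ℓ u^ℓ` (zero for `n = 0, 1`, as the sum is empty). -/
noncomputable def rowPoly (n : ℕ) : ℚ[X] :=
  ∑ ℓ ∈ Finset.Icc 1 (n - 1), Polynomial.C (t n ℓ : ℚ) * Polynomial.X ^ ℓ

/-- The bivariate generating function `g(x,u) = ∑_{n ≥ 2} ∑_{ℓ=1}^{n-1} t n ℓ u^ℓ x^n` as a
formal power series; variable `0` is `x` and variable `1` is `u`. -/
noncomputable def g : MvPowerSeries (Fin 2) ℚ :=
  fun e => (rowPoly (e 0)).coeff (e 1)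

/-- The specialization `g(x,1)`: every coefficient of a power of `x` in `g(x,u)` is a polynomial
in `u`, and it is evaluated at `u = 1`. -/
noncomputable def gAtOne : ℚ⟦X⟧ :=
  PowerSeries.mk fun n => (rowPoly n).eval 1

/-- The formal variable `x`. -/
noncomputable def x : MvPowerSeries (Fin 2) ℚ := MvPowerSeries.X 0

/-- The formal variable `u`. -/
noncomputable def u : MvPowerSeries (Fin 2) ℚ := MvPowerSeries.X 1

end PatternAvoid

namespace PatternAvoid

/-! Permutations are built from right to left by prepending a first entry. A new first entry can
only play the `1` of `1243` or `1324`, so it is harmless exactly when the entries above it avoid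
`132` and `213`; unless it is the new minimum or maximum, it does not affect the adjacency of the
extreme entries.

For fixed `v`, the admissible nonextreme first entries are those from a threshold `m` on. A second
threshold `d`, above which `v` is increasing, governs what may be prepended next
(`exists_thresholds`). Comparing the two shows that prepending `j` and then a fixed `c` can be done
in as many ways as there are admissible `j ≤ c` (`card_prepend_prepend`). Hence, away from the first
column, each row of `t` consists of partial sums of the row before it (`t_add_three`). The first
column counts permutations avoiding `132` and `213`, a power of two.

These data determine `t`: the entries are partial sums of binomial coefficients (`t_eq_sum_choose`),
and the last entry of a row, which is also the total of the previous row, is a central binomial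
coefficient. Differencing the partial sums gives a Pascal-type rule, which is multiplication of `g`
by `1 - u - x`. The rule fails only in the first two columns and just past the end of each row, and
these failures are the two terms in the bracket (`mul_g`). -/

/-- The entries of `v` that are at least `c` avoid `132` and `213`. -/
def UpperAvoids {n : ℕ} (v : Equiv.Perm (Fin n)) (c : ℕ) : Prop :=
  ∀ i j k : Fin n, i < j → j < k → c ≤ (v i : ℕ) → c ≤ (v j : ℕ) → c ≤ (v k : ℕ) →
    ¬ (v i < v k ∧ v k < v j) ∧ ¬ (v j < v i ∧ v i < v k)

/-- The entries of `v` that are at least `c` are increasing. -/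
def UpperIncreasing {n : ℕ} (v : Equiv.Perm (Fin n)) (c : ℕ) : Prop :=
  ∀ i j : Fin n, i < j → c ≤ (v i : ℕ) → c ≤ (v j : ℕ) → v i < v j

/-! ### Prepending a first entry -/

/-- Prepend the entry `c`, moving up the entries that are at least `c`. -/
def prepend {n : ℕ} (c : Fin (n + 1)) (v : Equiv.Perm (Fin n)) : Equiv.Perm (Fin (n + 1)) :=
  (finSuccEquiv' 0).trans (v.optionCongr.trans (finSuccEquiv' c).symm)

@[simp] lemma prepend_zero {n : ℕ} (c : Fin (n + 1)) (v : Equiv.Perm (Fin n)) :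
    prepend c v 0 = c := by
  simp [prepend]

@[simp] lemma prepend_succ {n : ℕ} (c : Fin (n + 1)) (v : Equiv.Perm (Fin n)) (i : Fin n) :
    prepend c v i.succ = c.succAbove (v i) := by
  have h : finSuccEquiv' (0 : Fin (n + 1)) i.succ = some i := by
    rw [← Fin.succAbove_zero_apply, finSuccEquiv'_succAbove]
  simp [prepend, h]

lemma prepend_injective {n : ℕ} :
    Function.Injective fun x : Fin (n + 1) × Equiv.Perm (Fin n) => prepend x.1 x.2 := by
  rintro ⟨c, v⟩ ⟨d, w⟩ h
  have h' : prepend c v = prepend d w := h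
  have h0 : c = d := by simpa using congrArg (fun f : Equiv.Perm _ => f 0) h'
  subst h0
  refine Prod.ext rfl (Equiv.ext fun i => ?_)
  simpa using congrArg (fun f : Equiv.Perm _ => f i.succ) h'

/-- A permutation is its first entry together with the pattern of the others. -/
noncomputable def prependEquiv (n : ℕ) :
    Fin (n + 1) × Equiv.Perm (Fin n) ≃ Equiv.Perm (Fin (n + 1)) :=
  Equiv.ofBijective (fun x => prepend x.1 x.2) <|
    (Fintype.bijective_iff_injective_and_card _).2
      ⟨prepend_injective, by simp [Fintype.card_perm, Nat.factorial_succ]⟩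

lemma prepend_succ_lt_succ {n : ℕ} (c : Fin (n + 1)) (v : Equiv.Perm (Fin n)) (a b : Fin n) :
    prepend c v a.succ < prepend c v b.succ ↔ v a < v b := by
  simp [Fin.succAbove_lt_succAbove_iff]

lemma val_prepend_succ {n : ℕ} (c : Fin (n + 1)) (v : Equiv.Perm (Fin n)) (i : Fin n) :
    (prepend c v i.succ : ℕ) = if (v i : ℕ) < c then (v i : ℕ) else v i + 1 := by
  rw [prepend_succ, Fin.succAbove]
  split_ifs with h h' h' <;> simp_all [Fin.lt_def]

lemma lt_prepend_succ {n : ℕ} (c : Fin (n + 1)) (v : Equiv.Perm (Fin n)) (i : Fin n) :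
    c < prepend c v i.succ ↔ (c : ℕ) ≤ v i := by
  rw [Fin.lt_def, val_prepend_succ]; split_ifs <;> omega

lemma prepend_succ_lt {n : ℕ} (c : Fin (n + 1)) (v : Equiv.Perm (Fin n)) (i : Fin n) :
    prepend c v i.succ < c ↔ (v i : ℕ) < c := by
  rw [Fin.lt_def, val_prepend_succ]; split_ifs <;> omega

lemma le_prepend_succ {n : ℕ} {c : Fin (n + 1)} (v : Equiv.Perm (Fin n)) (i : Fin n) {e : ℕ}
    (h : e ≤ (c : ℕ)) : e ≤ (prepend c v i.succ : ℕ) ↔ e ≤ (v i : ℕ) := by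
  rw [val_prepend_succ]; split_ifs <;> omega

/-- `σ` has no occurrence of `1243` or `1324`, spelled out. -/
lemma mem_avoiders_iff {n : ℕ} (σ : Equiv.Perm (Fin n)) :
    σ ∈ avoiders n {p1243, p1324} ↔ ∀ i j k l : Fin n, i < j → j < k → k < l →
      ¬ (σ i < σ j ∧ σ j < σ l ∧ σ l < σ k) ∧ ¬ (σ i < σ k ∧ σ k < σ j ∧ σ j < σ l) := by
  have key : ∀ i j k l : Fin n, i < j → j < k → k < l →
      ∃ f : Fin 4 ↪o Fin n, f 0 = i ∧ f 1 = j ∧ f 2 = k ∧ f 3 = l := by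
    intro i j k l h1 h2 h3
    refine ⟨OrderEmbedding.ofStrictMono ![i, j, k, l] ?_, rfl, rfl, rfl, rfl⟩
    rw [Fin.strictMono_iff_lt_succ]
    intro a
    fin_cases a <;> simpa
  simp only [avoiders, Set.mem_ofPred_eq, Set.mem_insert_iff, Set.mem_singleton_iff,
    forall_eq_or_imp, forall_eq]
  constructor
  · rintro ⟨hA, hB⟩ i j k l h1 h2 h3
    obtain ⟨f, rfl, rfl, rfl, rfl⟩ := key i j k l h1 h2 h3
    constructor
    · rintro ⟨a1, a2, a3⟩
      refine hA ⟨f, fun a b => ?_⟩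
      fin_cases a <;> fin_cases b <;> simp [p1243] <;> order
    · rintro ⟨a1, a2, a3⟩
      refine hB ⟨f, fun a b => ?_⟩
      fin_cases a <;> fin_cases b <;> simp [p1324] <;> order
  · intro h
    constructor
    · rintro ⟨f, hf⟩
      refine (h (f 0) (f 1) (f 2) (f 3) (by simp) (by simp) (by simp)).1 ⟨?_, ?_, ?_⟩ <;>
        rw [hf] <;> decide
    · rintro ⟨f, hf⟩
      refine (h (f 0) (f 1) (f 2) (f 3) (by simp) (by simp) (by simp)).2 ⟨?_, ?_, ?_⟩ <;>
        rw [hf] <;> decide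

/-- Both patterns begin with their minimum, so the new entry can only play that role; what remains
of `1243` and `1324` is `132` and `213`. -/
lemma prepend_mem_avoiders_iff {n : ℕ} (c : Fin (n + 1)) (v : Equiv.Perm (Fin n)) :
    prepend c v ∈ avoiders (n + 1) {p1243, p1324} ↔
      v ∈ avoiders n {p1243, p1324} ∧ UpperAvoids v c := by
  rw [mem_avoiders_iff, mem_avoiders_iff]
  constructor
  · refine fun h => ⟨fun i j k l h1 h2 h3 => ?_, fun i j k h1 h2 h3 h4 h5 => ?_⟩
    · simpa only [prepend_succ_lt_succ] using h i.succ j.succ k.succ l.succ (by simpa) (by simpa)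
        (by simpa)
    · have := h 0 i.succ j.succ k.succ (by simp) (by simpa) (by simpa)
      simp only [prepend_succ_lt_succ, prepend_zero, lt_prepend_succ] at this
      tauto
  · rintro ⟨hA, hB⟩ i j k l h1 h2 h3
    obtain ⟨j, rfl⟩ := Fin.exists_succ_eq.2 (Fin.ne_zero_of_lt h1)
    obtain ⟨k, rfl⟩ := Fin.exists_succ_eq.2 (Fin.ne_zero_of_lt h2)
    obtain ⟨l, rfl⟩ := Fin.exists_succ_eq.2 (Fin.ne_zero_of_lt h3)
    rw [Fin.succ_lt_succ_iff] at h2 h3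
    induction i using Fin.cases with
    | zero =>
      simp only [prepend_succ_lt_succ, prepend_zero, lt_prepend_succ]
      have := hB j k l h2 h3
      simp only [Fin.lt_def] at this ⊢
      constructor <;> intro h' <;> have := this (by omega) (by omega) (by omega) <;> omega
    | succ i =>
      simp only [prepend_succ_lt_succ]
      exact hA i j k l (by simpa using h1) h2 h3

/-- The new entry lies below `c` and plays no part; the entries seen by the conclusion all come from
entries of `v` that are at least `j`. -/
lemma upperAvoids_prepend_of_lt {n : ℕ} {j : Fin (n + 1)} {v : Equiv.Perm (Fin n)} {c : ℕ}
    (hj : UpperAvoids v j) (hc : (j : ℕ) < c) : UpperAvoids (prepend j v) c := by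
  have hval : ∀ i : Fin n, c ≤ (prepend j v i.succ : ℕ) → (j : ℕ) ≤ v i := by
    intro i hi
    rw [← le_prepend_succ v i le_rfl]; omega
  intro a b d hab hbd ha hb hd
  obtain ⟨a, rfl⟩ : ∃ a', Fin.succ a' = a := Fin.exists_succ_eq.2 (by
    rintro rfl
    rw [prepend_zero] at ha; omega)
  obtain ⟨b, rfl⟩ := Fin.exists_succ_eq.2 (Fin.ne_zero_of_lt hab)
  obtain ⟨d, rfl⟩ := Fin.exists_succ_eq.2 (Fin.ne_zero_of_lt hbd)
  simp only [prepend_succ_lt_succ]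
  exact hj a b d (by simpa using hab) (by simpa using hbd) (hval a ha) (hval b hb) (hval d hd)

/-- The new entry can be the `1` of a `132`, which the second condition excludes, or the `2` of a
`213`, which the third excludes. -/
lemma upperAvoids_prepend_iff {n : ℕ} {j : Fin (n + 1)} {v : Equiv.Perm (Fin n)} {c : ℕ}
    (hc : c ≤ (j : ℕ)) : UpperAvoids (prepend j v) c ↔
      UpperAvoids v c ∧ UpperIncreasing v j ∧
        ∀ a b : Fin n, a < b → c ≤ (v a : ℕ) → (v a : ℕ) < j → (v b : ℕ) < j := by
  constructor
  · refine fun h => ⟨fun a b d hab hbd ha hb hd => ?_, fun a b hab ha hb => ?_,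
      fun a b hab ha haj => ?_⟩
    · simpa only [prepend_succ_lt_succ] using h a.succ b.succ d.succ (by simpa) (by simpa)
        ((le_prepend_succ v _ hc).2 ha) ((le_prepend_succ v _ hc).2 hb)
        ((le_prepend_succ v _ hc).2 hd)
    · have := (h 0 a.succ b.succ (by simp) (by simpa) (by simpa)
        ((le_prepend_succ v _ hc).2 (by omega)) ((le_prepend_succ v _ hc).2 (by omega))).1
      rw [prepend_succ_lt_succ, prepend_zero, lt_prepend_succ] at this
      have hne : v a ≠ v b := fun h' => hab.ne (v.injective h')
      exact lt_of_le_of_ne (not_lt.1 fun h' => this ⟨hb, h'⟩) hne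
    · by_contra hb
      rw [not_lt] at hb
      have := (h 0 a.succ b.succ (by simp) (by simpa) (by simpa)
        ((le_prepend_succ v _ hc).2 (by omega)) ((le_prepend_succ v _ hc).2 (by omega))).2
      rw [prepend_zero, lt_prepend_succ, prepend_succ_lt] at this
      exact this ⟨haj, hb⟩
  · rintro ⟨h1, h2, h3⟩ a b d hab hbd ha hb hd
    obtain ⟨b, rfl⟩ := Fin.exists_succ_eq.2 (Fin.ne_zero_of_lt hab)
    obtain ⟨d, rfl⟩ := Fin.exists_succ_eq.2 (Fin.ne_zero_of_lt hbd)
    rw [le_prepend_succ v _ hc] at hb hd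
    rw [Fin.succ_lt_succ_iff] at hbd
    induction a using Fin.cases with
    | zero =>
      simp only [prepend_succ_lt_succ, prepend_zero, lt_prepend_succ, prepend_succ_lt]
      refine ⟨fun h => ?_, fun h => ?_⟩
      · exact lt_asymm h.2 (h2 b d hbd (h.1.trans h.2.le) h.1)
      · exact absurd (h3 b d hbd hb h.1) (not_lt.2 h.2)
    | succ a =>
      rw [le_prepend_succ v _ hc] at ha
      simp only [prepend_succ_lt_succ]
      exact h1 a b d (by simpa using hab) hbd ha hb hd

lemma UpperAvoids.mono {n : ℕ} {v : Equiv.Perm (Fin n)} {c d : ℕ} (h : UpperAvoids v c)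
    (hcd : c ≤ d) : UpperAvoids v d := fun i j k hij hjk hi hj hk =>
  h i j k hij hjk (hcd.trans hi) (hcd.trans hj) (hcd.trans hk)

lemma UpperIncreasing.mono {n : ℕ} {v : Equiv.Perm (Fin n)} {c d : ℕ} (h : UpperIncreasing v c)
    (hcd : c ≤ d) : UpperIncreasing v d := fun i j hij hi hj =>
  h i j hij (hcd.trans hi) (hcd.trans hj)

lemma UpperIncreasing.upperAvoids {n : ℕ} {v : Equiv.Perm (Fin n)} {c : ℕ}
    (h : UpperIncreasing v c) : UpperAvoids v c := fun i j k hij hjk hi hj hk =>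
  ⟨fun h' => lt_asymm (h j k hjk hj hk) h'.2, fun h' => lt_asymm (h i j hij hi hj) h'.1⟩

lemma upperIncreasing_last {N : ℕ} (v : Equiv.Perm (Fin (N + 1))) : UpperIncreasing v N := by
  intro i j hij hi hj
  exact absurd (v.injective (Fin.ext (by omega) : v i = v j)) hij.ne

/-! ### Thresholds for admissible first entries -/

/-- Let `d` be least such that the entries `≥ d` of `v` increase. Entries in `[c, d)` stand after
all entries `≥ d` when the entries `≥ c` of `v` avoid `132` and `213`. -/
lemma lt_of_upperAvoids_of_minimal {N : ℕ} {v : Equiv.Perm (Fin (N + 1))} {c d : ℕ}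
    (hc : 1 ≤ c) (hdN : d ≤ N) (hv : UpperAvoids v c) (hd : UpperIncreasing v d)
    (hmin : ∀ e, 1 ≤ e → e < d → ¬ UpperIncreasing v e) {a b : Fin (N + 1)} (hab : a < b)
    (hca : c ≤ (v a : ℕ)) (had : (v a : ℕ) < d) : (v b : ℕ) < d := by
  by_contra hb
  rw [not_lt] at hb
  obtain ⟨q, hq⟩ := v.surjective (Fin.last N)
  obtain ⟨e, he⟩ := v.surjective ⟨d - 1, by omega⟩
  have hqv : (v q : ℕ) = N := by rw [hq]; rfl
  have hev : (v e : ℕ) = d - 1 := by rw [he]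
  have hbq : b ≤ q := by
    by_contra h
    have := hd q b (not_le.1 h) (by omega) hb
    rw [Fin.lt_def] at this
    have := (v b).isLt
    omega
  have haq : a < q := hab.trans_le hbq
  -- If `d - 1` stands before the maximum, avoidance of `213` puts it before all entries `≥ d`,
  -- against the minimality of `d`. If it stands after, then `v a`, `N`, `d - 1` is a `132`.
  rcases lt_trichotomy e q with h | h | h
  · refine hmin (d - 1) (by omega) (by omega) fun i j hij hi hj => ?_
    rcases eq_or_lt_of_le hi with hi' | hi'
    · have hne : v i ≠ v j := fun h' => hij.ne (v.injective h')
      rw [Fin.lt_def]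
      have : (v i : ℕ) ≠ v j := fun h' => hne (Fin.ext h')
      omega
    · rcases eq_or_lt_of_le hj with hj' | hj'
      · have hje : j = e := v.injective (Fin.ext (by omega))
        subst hje
        have hiq : (v i : ℕ) ≠ N := fun h' =>
          (hij.trans h).ne (v.injective (Fin.ext (by omega)))
        have := (v i).isLt
        refine absurd ?_ (hv i j q hij h (by omega) (by omega) (by omega)).2
        simp only [Fin.lt_def]
        omega
      · exact hd i j hij (by omega) (by omega)
  · subst h; omega
  · have hne : (v a : ℕ) ≠ v e := fun h' => (haq.trans h).ne (v.injective (Fin.ext h'))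
    refine (hv a q e haq h hca (by omega) (by omega)).1 ?_
    simp only [Fin.lt_def]
    omega

/-- The entries that can be prepended to `v`, and those that can be prepended afterwards. -/
lemma exists_thresholds {N : ℕ} (hN : 1 ≤ N) (v : Equiv.Perm (Fin (N + 1))) :
    ∃ m d : ℕ, 1 ≤ m ∧ m ≤ d ∧ d ≤ N ∧ (∀ j, 1 ≤ j → (UpperAvoids v j ↔ m ≤ j)) ∧
      ∀ (j : Fin (N + 2)) (c : ℕ), 1 ≤ c → m ≤ (j : ℕ) → (j : ℕ) ≤ N →
        (UpperAvoids (prepend j v) c ↔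
          ((j : ℕ) < d ∧ (j : ℕ) < c) ∨ ((j : ℕ) = d ∧ m ≤ c) ∨ (d < (j : ℕ) ∧ (j : ℕ) ≤ c)) := by
  classical
  have hex : ∃ j, 1 ≤ j ∧ UpperAvoids v j := ⟨N, hN, (upperIncreasing_last v).upperAvoids⟩
  have hex' : ∃ j, 1 ≤ j ∧ UpperIncreasing v j := ⟨N, hN, upperIncreasing_last v⟩
  obtain ⟨hm1, hm2⟩ := Nat.find_spec hex
  obtain ⟨hd1, hd2⟩ := Nat.find_spec hex'
  have hm3 : ∀ e, 1 ≤ e → e < Nat.find hex → ¬ UpperAvoids v e :=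
    fun e he h h' => Nat.find_min hex h ⟨he, h'⟩
  have hd3 : ∀ e, 1 ≤ e → e < Nat.find hex' → ¬ UpperIncreasing v e :=
    fun e he h h' => Nat.find_min hex' h ⟨he, h'⟩
  have hmd : Nat.find hex ≤ Nat.find hex' := Nat.find_min' hex ⟨hd1, hd2.upperAvoids⟩
  have hdN : Nat.find hex' ≤ N := Nat.find_min' hex' ⟨hN, upperIncreasing_last v⟩
  generalize Nat.find hex = m at *
  generalize Nat.find hex' = d at *
  have hm : ∀ j, 1 ≤ j → (UpperAvoids v j ↔ m ≤ j) := fun j hj =>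
    ⟨fun h => not_lt.1 fun h' => hm3 j hj h' h, fun h => hm2.mono h⟩
  refine ⟨m, d, hm1, hmd, hdN, hm, fun j c hc hmj hjN => ?_⟩
  rcases lt_or_ge (j : ℕ) c with hjc | hjc
  · have := upperAvoids_prepend_of_lt (hm2.mono hmj) hjc
    simp only [this, true_iff]
    omega
  · rw [upperAvoids_prepend_iff hjc, hm c hc]
    rcases lt_trichotomy (j : ℕ) d with h | h | h
    · have := hd3 j (by omega) h
      simp only [this, false_and, and_false, false_iff]
      omega
    · have hiff : ((j : ℕ) < d ∧ (j : ℕ) < c ∨ (j : ℕ) = d ∧ m ≤ c ∨ d < (j : ℕ) ∧ (j : ℕ) ≤ c) ↔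
          m ≤ c := by omega
      rw [hiff, h]
      refine ⟨fun h' => h'.1, fun h' => ⟨h', hd2, fun a b hab hca had => ?_⟩⟩
      exact lt_of_upperAvoids_of_minimal hc hdN ((hm c hc).2 h') hd2 hd3 hab hca had
    · have hiff : ((j : ℕ) < d ∧ (j : ℕ) < c ∨ (j : ℕ) = d ∧ m ≤ c ∨ d < (j : ℕ) ∧ (j : ℕ) ≤ c) ↔
          c = j := by omega
      rw [hiff]
      constructor
      -- If `c < j`, the entry `j - 1` is at least `d` and so precedes the maximum; with the new
      -- entry in front they form a `213`.
      · rintro ⟨-, -, h3⟩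
        by_contra hne
        obtain ⟨q, hq⟩ := v.surjective (Fin.last N)
        obtain ⟨a, ha⟩ := v.surjective ⟨(j : ℕ) - 1, by omega⟩
        have hqv : (v q : ℕ) = N := by rw [hq]; rfl
        have hav : (v a : ℕ) = j - 1 := by rw [ha]
        rcases lt_trichotomy a q with h' | h' | h'
        · have := h3 a q h' (by omega) (by omega)
          omega
        · subst h'; omega
        · have := hd2 q a h' (by omega) (by omega)
          rw [Fin.lt_def] at this
          omega
      · intro hcj
        exact ⟨by omega, hd2.mono h.le, fun a b hab h1 h2 => by omega⟩

open Finset in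
open scoped Classical in
/-- For fixed `v`, prepending first `j` and then `c` can be done in as many ways as there are
admissible `j ≤ c`. -/
lemma card_prepend_prepend {N c : ℕ} (v : Equiv.Perm (Fin (N + 1))) (hc : 1 ≤ c) :
    #{j : Fin (N + 2) | (1 ≤ (j : ℕ) ∧ (j : ℕ) ≤ N ∧ UpperAvoids v j) ∧
        UpperAvoids (prepend j v) c} =
      #{j : Fin (N + 2) | (1 ≤ (j : ℕ) ∧ (j : ℕ) ≤ N ∧ UpperAvoids v j) ∧ (j : ℕ) ≤ c} := by
  rcases Nat.eq_zero_or_pos N with rfl | hN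
  · congr 1
  obtain ⟨m, d, hm1, hmd, hdN, hm, hj⟩ := exists_thresholds hN v
  have hP : ∀ (P : ℕ → Prop) [DecidablePred P], #{j : Fin (N + 2) | P j} = #{j ∈ range (N + 2) | P j} := by
    intro P _
    rw [← Finset.card_map Fin.valEmbedding]
    congr 1
    ext j
    simp only [mem_map, mem_filter, mem_univ, true_and, Fin.valEmbedding_apply, mem_range]
    constructor
    · rintro ⟨a, ha, rfl⟩
      exact ⟨a.isLt, ha⟩
    · rintro ⟨h, ha⟩
      exact ⟨⟨j, h⟩, ha, rfl⟩
  have e1 : #{j : Fin (N + 2) | (1 ≤ (j : ℕ) ∧ (j : ℕ) ≤ N ∧ UpperAvoids v j) ∧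
        UpperAvoids (prepend j v) c} = #{j : Fin (N + 2) | m ≤ (j : ℕ) ∧ (j : ℕ) ≤ N ∧
          (((j : ℕ) < d ∧ (j : ℕ) < c) ∨ ((j : ℕ) = d ∧ m ≤ c) ∨
            (d < (j : ℕ) ∧ (j : ℕ) ≤ c))} := by
    congr 1
    ext j
    simp only [mem_filter, mem_univ, true_and]
    constructor
    · rintro ⟨⟨h1, h2, h3⟩, h4⟩
      rw [hm _ h1] at h3
      exact ⟨h3, h2, (hj j c hc h3 h2).1 h4⟩
    · rintro ⟨h1, h2, h3⟩
      exact ⟨⟨hm1.trans h1, h2, (hm _ (hm1.trans h1)).2 h1⟩, (hj j c hc h1 h2).2 h3⟩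
  have e2 : #{j : Fin (N + 2) | (1 ≤ (j : ℕ) ∧ (j : ℕ) ≤ N ∧ UpperAvoids v j) ∧ (j : ℕ) ≤ c} =
      #{j : Fin (N + 2) | m ≤ (j : ℕ) ∧ (j : ℕ) ≤ N ∧ (j : ℕ) ≤ c} := by
    congr 1
    ext j
    simp only [mem_filter, mem_univ, true_and]
    constructor
    · rintro ⟨⟨h1, h2, h3⟩, h4⟩
      exact ⟨(hm _ h1).1 h3, h2, h4⟩
    · rintro ⟨h1, h2, h3⟩
      exact ⟨⟨hm1.trans h1, h2, (hm _ (hm1.trans h1)).2 h1⟩, h3⟩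
  rw [e1, e2, hP fun j => m ≤ j ∧ j ≤ N ∧ ((j < d ∧ j < c) ∨ (j = d ∧ m ≤ c) ∨ (d < j ∧ j ≤ c)),
    hP fun j => m ≤ j ∧ j ≤ N ∧ j ≤ c]
  rcases lt_or_ge c m with hcm | hcm
  · congr 1
    ext j
    simp only [mem_filter, mem_range]
    omega
  rcases lt_or_ge c d with hcd | hcd
  -- For `m ≤ c < d`, the value `j = c` is lost and `j = d` is gained, so the counts agree although
  -- the sets differ.
  · trans c - m + 1
    · have : {j ∈ range (N + 2) | m ≤ j ∧ j ≤ N ∧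
          ((j < d ∧ j < c) ∨ (j = d ∧ m ≤ c) ∨ (d < j ∧ j ≤ c))} = insert d (Ico m c) := by
        ext j
        simp only [mem_filter, mem_range, mem_insert, mem_Ico]
        omega
      rw [this, card_insert_of_notMem (by simp only [mem_Ico]; omega), Nat.card_Ico]
    · have : {j ∈ range (N + 2) | m ≤ j ∧ j ≤ N ∧ j ≤ c} = Icc m c := by
        ext j
        simp only [mem_filter, mem_range, mem_Icc]
        omega
      rw [this, Nat.card_Icc]
      omega
  · congr 1
    ext j
    simp only [mem_filter, mem_range]
    omega

/-! ### Adjacency of the minimum and the maximum -/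

/-- The entry `1` stands immediately to the left of the entry `n`. -/
def MinBeforeMax {n : ℕ} (σ : Equiv.Perm (Fin n)) : Prop :=
  ∃ p q : Fin n, (σ p : ℕ) = 0 ∧ (σ q : ℕ) + 1 = n ∧ (q : ℕ) = p + 1

lemma mem_adjacentAvoiders_iff {n : ℕ} (σ : Equiv.Perm (Fin n)) :
    σ ∈ adjacentAvoiders n ↔ σ ∈ avoiders n {p1243, p1324} ∧ MinBeforeMax σ := by
  simp [adjacentAvoiders, avoidersDist, MinBeforeMax]

lemma minBeforeMax_prepend_iff {n : ℕ} {c : Fin (n + 1)} (hc : 1 ≤ (c : ℕ)) (hcn : (c : ℕ) < n)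
    (v : Equiv.Perm (Fin n)) : MinBeforeMax (prepend c v) ↔ MinBeforeMax v := by
  constructor
  · rintro ⟨p, q, hp, hq, hpq⟩
    obtain ⟨p, rfl⟩ : ∃ p', Fin.succ p' = p := Fin.exists_succ_eq.2 (by
      rintro rfl
      rw [prepend_zero] at hp; omega)
    obtain ⟨q, rfl⟩ : ∃ q', Fin.succ q' = q := Fin.exists_succ_eq.2 (by
      rintro rfl
      rw [prepend_zero] at hq; omega)
    simp only [Fin.val_succ, val_prepend_succ] at hp hq hpq
    refine ⟨p, q, ?_, ?_, by omega⟩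
    · split_ifs at hp; omega
    · split_ifs at hq <;> omega
  · rintro ⟨p, q, hp, hq, hpq⟩
    refine ⟨p.succ, q.succ, ?_, ?_, by simp [hpq]⟩ <;> rw [val_prepend_succ] <;>
      split_ifs <;> omega

lemma minBeforeMax_prepend_zero_iff {n : ℕ} (v : Equiv.Perm (Fin (n + 1))) :
    MinBeforeMax (prepend 0 v) ↔ v 0 = Fin.last n := by
  constructor
  · rintro ⟨p, q, hp, hq, hpq⟩
    have hp0 : p = 0 := (prepend 0 v).injective (by rw [prepend_zero]; exact Fin.ext hp)
    subst hp0
    have hq1 : q = Fin.succ 0 := Fin.ext (by simpa using hpq)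
    subst hq1
    rw [val_prepend_succ] at hq
    refine Fin.ext ?_
    simp at hq ⊢
    omega
  · intro h
    refine ⟨0, Fin.succ 0, by simp, ?_, by simp⟩
    rw [val_prepend_succ, h]
    simp

lemma not_minBeforeMax_prepend_last {n : ℕ} (v : Equiv.Perm (Fin n)) :
    ¬ MinBeforeMax (prepend (Fin.last n) v) := by
  rintro ⟨p, q, hp, hq, hpq⟩
  have hq0 : q = 0 := (prepend (Fin.last n) v).injective (by
    rw [prepend_zero]; exact Fin.ext (by simpa using hq))
  subst hq0
  simp at hpq

/-- The bound `c < n` is there because a leading maximum has nothing to its left. -/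
lemma prepend_mem_adjacentAvoiders_iff {n : ℕ} {c : Fin (n + 1)} (hc : 1 ≤ (c : ℕ))
    (v : Equiv.Perm (Fin n)) : prepend c v ∈ adjacentAvoiders (n + 1) ↔
      v ∈ adjacentAvoiders n ∧ (c : ℕ) < n ∧ UpperAvoids v c := by
  rw [mem_adjacentAvoiders_iff, mem_adjacentAvoiders_iff, prepend_mem_avoiders_iff]
  rcases lt_or_ge (c : ℕ) n with hcn | hcn
  · rw [minBeforeMax_prepend_iff hc hcn]
    tauto
  · have : c = Fin.last n := Fin.ext (by have := c.isLt; simp; omega)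
    subst this
    have := not_minBeforeMax_prepend_last v
    simp [this]

lemma UpperAvoids.mem_avoiders {n : ℕ} {v : Equiv.Perm (Fin n)} (h : UpperAvoids v 0) :
    v ∈ avoiders n {p1243, p1324} := by
  rw [mem_avoiders_iff]
  intro i j k l h1 h2 h3
  refine ⟨fun h' => (h j k l h2 h3 (by simp) (by simp) (by simp)).1 ⟨h'.2.1, h'.2.2⟩,
    fun h' => (h j k l h2 h3 (by simp) (by simp) (by simp)).2 ⟨h'.2.1, h'.2.2⟩⟩

/-- Starting with `1, n`: what follows avoids `132` and `213`. -/
lemma prepend_zero_mem_adjacentAvoiders_iff {n : ℕ} (v : Equiv.Perm (Fin (n + 1))) :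
    prepend 0 v ∈ adjacentAvoiders (n + 2) ↔ v 0 = Fin.last n ∧ UpperAvoids v 0 := by
  rw [mem_adjacentAvoiders_iff, prepend_mem_avoiders_iff, minBeforeMax_prepend_zero_iff]
  exact ⟨fun h => ⟨h.2, h.1.2⟩, fun h => ⟨⟨h.2.mem_avoiders, h.2⟩, h.1⟩⟩

/-- Permutations that start with `1` admit every entry as a new first entry. -/
lemma upperAvoids_of_mem_adjacentAvoiders {n : ℕ} {v : Equiv.Perm (Fin (n + 1))}
    (hv : v ∈ adjacentAvoiders (n + 1)) (h0 : v 0 = 0) (c : ℕ) (hc : 1 ≤ c) : UpperAvoids v c := by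
  rw [mem_adjacentAvoiders_iff, mem_avoiders_iff] at hv
  intro i j k hij hjk hi hj hk
  have hi0 : 0 < i := by
    rw [Fin.pos_iff_ne_zero]
    rintro rfl
    rw [h0] at hi
    simp at hi; omega
  have h0i : v 0 < v i := by rw [h0, Fin.lt_def, Fin.val_zero]; omega
  have h0j : v 0 < v j := by rw [h0, Fin.lt_def, Fin.val_zero]; omega
  have := hv.1 0 i j k hi0 hij hjk
  tauto

/-! ### The row recurrence -/

lemma exists_eq_prepend {n : ℕ} (σ : Equiv.Perm (Fin (n + 1))) : ∃ j v, σ = prepend j v := by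
  obtain ⟨⟨j, v⟩, h⟩ := (prependEquiv n).surjective σ
  exact ⟨j, v, h.symm⟩

open Finset in
lemma card_filter_eq_sum_prepend {n : ℕ} (P : Equiv.Perm (Fin (n + 1)) → Prop)
    [DecidablePred P] :
    #{σ | P σ} = ∑ v : Equiv.Perm (Fin n), #{j : Fin (n + 1) | P (prepend j v)} := by
  simp only [card_filter]
  rw [← Equiv.sum_comp (prependEquiv n), Fintype.sum_prod_type_right]
  rfl

lemma apply_zero_le_of_mem_adjacentAvoiders {n : ℕ} {σ : Equiv.Perm (Fin (n + 2))}
    (hσ : σ ∈ adjacentAvoiders (n + 2)) : (σ 0 : ℕ) ≤ n := by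
  obtain ⟨j, v, rfl⟩ := exists_eq_prepend σ
  rw [prepend_zero]
  rcases Nat.eq_zero_or_pos (j : ℕ) with hj | hj
  · omega
  · have := ((prepend_mem_adjacentAvoiders_iff hj v).1 hσ).2.1
    omega

open Finset in
open scoped Classical in
lemma t_succ_succ (n c : ℕ) : t (n + 1) (c + 1) =
    #{σ : Equiv.Perm (Fin (n + 1)) | σ ∈ adjacentAvoiders (n + 1) ∧ (σ 0 : ℕ) = c} := by
  rw [t, ← Set.ncard_coe_finset]
  congr 1
  ext σ
  simp only [coe_filter, mem_univ, true_and, Set.mem_ofPred_eq, and_congr_right_iff]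
  intro _
  constructor
  · rintro ⟨i, hi, h⟩
    obtain rfl : i = 0 := Fin.ext hi
    omega
  · intro h
    exact ⟨0, rfl, by omega⟩

lemma t_eq_zero {n ℓ : ℕ} (h : n + 2 ≤ ℓ) : t (n + 2) ℓ = 0 := by
  obtain ⟨c, rfl⟩ : ∃ c, ℓ = c + 1 := ⟨ℓ - 1, by omega⟩
  classical
  rw [t_succ_succ, Finset.card_eq_zero, Finset.filter_eq_empty_iff]
  rintro σ - ⟨h1, h2⟩
  have := apply_zero_le_of_mem_adjacentAvoiders h1
  omega

open Finset in
open scoped Classical in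
lemma t_succ_succ_eq_card_upperAvoids {n c : ℕ} (hc : 1 ≤ c) (hcn : c < n) :
    t (n + 1) (c + 1) =
      #{v : Equiv.Perm (Fin n) | v ∈ adjacentAvoiders n ∧ UpperAvoids v c} := by
  rw [t_succ_succ]
  have hinj : Function.Injective (prepend (⟨c, by omega⟩ : Fin (n + 1))) := fun v w h =>
    (Prod.ext_iff.1 (prepend_injective (a₁ := (_, v)) (a₂ := (_, w)) h)).2
  rw [← card_image_of_injective _ hinj]
  congr 1
  ext σ
  simp only [mem_filter, mem_univ, true_and, mem_image]
  constructor
  · rintro ⟨h1, h2⟩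
    obtain ⟨j, v, rfl⟩ := exists_eq_prepend σ
    rw [prepend_zero] at h2
    subst h2
    have := (prepend_mem_adjacentAvoiders_iff hc v).1 h1
    exact ⟨v, ⟨this.1, this.2.2⟩, rfl⟩
  · rintro ⟨v, ⟨h1, h2⟩, rfl⟩
    exact ⟨(prepend_mem_adjacentAvoiders_iff (by exact hc) v).2 ⟨h1, hcn, h2⟩, by simp⟩

-- Permutations starting with their minimum satisfy both conditions. The others are grouped by what
-- remains after deleting the first entry, and `card_prepend_prepend` compares the counts in each
-- group.
open Finset in
open scoped Classical in
lemma card_upperAvoids_eq_card_apply_zero_le {N c : ℕ} (hc : 1 ≤ c) :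
    #{v : Equiv.Perm (Fin (N + 2)) | v ∈ adjacentAvoiders (N + 2) ∧ UpperAvoids v c} =
      #{v : Equiv.Perm (Fin (N + 2)) | v ∈ adjacentAvoiders (N + 2) ∧ (v 0 : ℕ) ≤ c} := by
  rw [← card_filter_add_card_filter_not (fun v : Equiv.Perm (Fin (N + 2)) => v 0 = 0),
    ← card_filter_add_card_filter_not
      (fun v : Equiv.Perm (Fin (N + 2)) => v 0 = 0) (s := {v : Equiv.Perm (Fin (N + 2)) |
        v ∈ adjacentAvoiders (N + 2) ∧ (v 0 : ℕ) ≤ c})]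
  simp only [filter_filter]
  congr 1
  · congr 1
    ext v
    simp only [mem_filter, mem_univ, true_and]
    constructor
    · rintro ⟨⟨h1, h2⟩, h3⟩
      exact ⟨⟨h1, by simp [h3]⟩, h3⟩
    · rintro ⟨⟨h1, h2⟩, h3⟩
      exact ⟨⟨h1, upperAvoids_of_mem_adjacentAvoiders h1 h3 c hc⟩, h3⟩
  · rw [card_filter_eq_sum_prepend, card_filter_eq_sum_prepend]
    refine sum_congr rfl fun v _ => ?_
    have hadj : ∀ (j : Fin (N + 2)) (P : Prop),
        ((prepend j v ∈ adjacentAvoiders (N + 2) ∧ P) ∧ ¬ prepend j v 0 = 0) ↔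
        (v ∈ adjacentAvoiders (N + 1) ∧ (1 ≤ (j : ℕ) ∧ (j : ℕ) ≤ N ∧ UpperAvoids v j) ∧ P) := by
      intro j P
      rw [prepend_zero]
      rcases Nat.eq_zero_or_pos (j : ℕ) with hj | hj
      · have : j = 0 := Fin.ext hj
        simp [this]
      · have : j ≠ 0 := by
          rintro rfl
          exact absurd hj (by simp)
        have h1 : 1 ≤ (j : ℕ) := hj
        rw [prepend_mem_adjacentAvoiders_iff hj, Nat.lt_succ_iff]
        tauto
    simp only [hadj]
    by_cases hv : v ∈ adjacentAvoiders (N + 1)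
    · simp only [hv, true_and, prepend_zero]
      convert card_prepend_prepend v hc
    · simp [hv]

open Finset in
open scoped Classical in
lemma card_apply_zero_le (n c : ℕ) :
    #{v : Equiv.Perm (Fin (n + 1)) | v ∈ adjacentAvoiders (n + 1) ∧ (v 0 : ℕ) ≤ c} =
      ∑ j ∈ range (c + 1), t (n + 1) (j + 1) := by
  rw [card_eq_sum_card_fiberwise (f := fun v => (v 0 : ℕ)) (t := range (c + 1))]
  · refine sum_congr rfl fun j hj => ?_
    rw [t_succ_succ, filter_filter]
    congr 1
    ext v
    simp only [mem_filter, mem_univ, true_and, mem_range] at hj ⊢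
    constructor
    · rintro ⟨⟨h1, -⟩, h2⟩
      exact ⟨h1, h2⟩
    · rintro ⟨h1, h2⟩
      exact ⟨⟨h1, by omega⟩, h2⟩
  · intro v hv
    simp only [coe_filter, mem_univ, true_and, Set.mem_ofPred_eq, coe_range, Set.mem_Iio] at hv ⊢
    omega

/-- The row `n + 1` consists of partial sums of the row `n`, apart from its first entry. -/
lemma t_add_three {N c : ℕ} (hc : 1 ≤ c) (hcN : c ≤ N + 1) :
    t (N + 3) (c + 1) = ∑ j ∈ Finset.range (c + 1), t (N + 2) (j + 1) := by
  rw [t_succ_succ_eq_card_upperAvoids hc (by omega), card_upperAvoids_eq_card_apply_zero_le hc,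
    card_apply_zero_le]

lemma ncard_adjacentAvoiders (N : ℕ) :
    (adjacentAvoiders (N + 2)).ncard = ∑ j ∈ Finset.range (N + 1), t (N + 2) (j + 1) := by
  classical
  rw [← card_apply_zero_le, ← Set.ncard_coe_finset]
  congr 1
  ext σ
  simp only [Finset.coe_filter, Finset.mem_univ, true_and, Set.mem_ofPred_eq]
  exact ⟨fun h => ⟨h, apply_zero_le_of_mem_adjacentAvoiders h⟩, fun h => h.1⟩

/-- The last entry of a row is the full sum of the row before it. -/
lemma ncard_adjacentAvoiders_eq_t (N : ℕ) :
    (adjacentAvoiders (N + 2)).ncard = t (N + 3) (N + 2) := by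
  rw [ncard_adjacentAvoiders, t_add_three (by omega) le_rfl, Finset.sum_range_succ _ (N + 1),
    t_eq_zero le_rfl, add_zero]

/-! ### The first column -/

-- The minimum in front forces the maximum next, and a leading maximum cannot start a `132` or a
-- `213`, so both can be deleted.
open Finset in
open scoped Classical in
lemma t_add_two_one (n : ℕ) :
    t (n + 2) 1 = #{v : Equiv.Perm (Fin n) | UpperAvoids v 0} := by
  have h := t_succ_succ (n + 1) 0
  rw [zero_add] at h
  have hinj : Function.Injective
      (fun v : Equiv.Perm (Fin n) => prepend 0 (prepend (Fin.last n) v)) := fun v w h =>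
    (Prod.ext_iff.1 (prepend_injective (a₁ := (_, v)) (a₂ := (_, w))
      (Prod.ext_iff.1 (prepend_injective (a₁ := (_, _)) (a₂ := (_, _)) h)).2)).2
  rw [h, ← card_image_of_injective _ hinj]
  have hlast : ∀ v : Equiv.Perm (Fin n), UpperAvoids (prepend (Fin.last n) v) 0 ↔
      UpperAvoids v 0 := by
    intro v
    rw [upperAvoids_prepend_iff (Nat.zero_le _)]
    refine ⟨fun h => h.1, fun h => ⟨h, fun a b _ ha _ => ?_, fun a b _ _ _ => ?_⟩⟩
    · have := (v a).isLt
      rw [Fin.val_last] at ha; omega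
    · rw [Fin.val_last]; exact (v b).isLt
  congr 1
  ext σ
  simp only [mem_filter, mem_univ, true_and, mem_image]
  constructor
  · rintro ⟨h1, h2⟩
    obtain ⟨j, v, rfl⟩ := exists_eq_prepend σ
    obtain ⟨k, v, rfl⟩ := exists_eq_prepend v
    rw [prepend_zero] at h2
    obtain rfl : j = 0 := Fin.ext h2
    rw [prepend_zero_mem_adjacentAvoiders_iff, prepend_zero] at h1
    obtain ⟨rfl, h1⟩ := h1
    exact ⟨v, (hlast v).1 h1, rfl⟩
  · rintro ⟨v, h1, rfl⟩
    rw [prepend_zero_mem_adjacentAvoiders_iff, prepend_zero, hlast]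
    exact ⟨⟨rfl, h1⟩, by simp⟩

/-- A `132`- and `213`-avoider can be extended in front only by a new maximum or by an entry just
below its first entry. -/
lemma upperAvoids_prepend_zero_iff {m : ℕ} {w : Equiv.Perm (Fin (m + 1))} (hw : UpperAvoids w 0)
    (j : Fin (m + 2)) :
    UpperAvoids (prepend j w) 0 ↔ j = Fin.last (m + 1) ∨ j = (w 0).castSucc := by
  rw [upperAvoids_prepend_iff (Nat.zero_le _)]
  constructor
  · rintro ⟨-, h2, h3⟩
    by_contra! h
    have hjm : (j : ℕ) ≤ m := by
      have := h.1
      rw [Ne, Fin.ext_iff, Fin.val_last] at this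
      omega
    have hj0 : (j : ℕ) ≠ w 0 := fun h' => h.2 (Fin.ext h')
    obtain ⟨q, hq⟩ := w.surjective (Fin.last m)
    obtain ⟨e, he⟩ := w.surjective ⟨j, by omega⟩
    have hqv : (w q : ℕ) = m := by rw [hq]; rfl
    have hev : (w e : ℕ) = j := by rw [he]
    -- If `j` is below `w 0`, a `132` arises from the new entry, `w 0` and the old entry `j`; if
    -- above, a `213` from the new entry, `w 0` and the maximum.
    rcases lt_or_gt_of_ne hj0 with h' | h'
    · have he0 : 0 < e := by
        rw [Fin.pos_iff_ne_zero]
        rintro rfl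
        omega
      have := h2 0 e he0 h'.le hev.ge
      rw [Fin.lt_def] at this
      omega
    · have hq0 : 0 < q := by
        rw [Fin.pos_iff_ne_zero]
        rintro rfl
        omega
      have := h3 0 q hq0 (Nat.zero_le _) h'
      omega
  · rintro (rfl | rfl)
    · refine ⟨hw, fun a b _ ha _ => ?_, fun a b _ _ _ => ?_⟩
      · have := (w a).isLt
        rw [Fin.val_last] at ha; omega
      · rw [Fin.val_last]; exact (w b).isLt
    · simp only [Fin.val_castSucc]
      refine ⟨hw, fun a b hab ha hb => ?_, fun a b hab _ ha => ?_⟩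
      · have hne : (w a : ℕ) ≠ w b := fun h' => hab.ne (w.injective (Fin.ext h'))
        have hb0 : (w 0 : ℕ) ≠ w b := fun h' =>
          (Fin.ne_zero_of_lt hab) (w.injective (Fin.ext h')).symm
        rw [Fin.lt_def]
        rcases Fin.eq_zero_or_eq_succ a with rfl | ⟨a', rfl⟩
        · omega
        · have := (hw 0 a'.succ b (Fin.succ_pos _) hab (Nat.zero_le _) (Nat.zero_le _)
            (Nat.zero_le _)).1
          simp only [Fin.lt_def] at this
          omega
      · have hb0 : (w 0 : ℕ) ≠ w b := fun h' =>
          (Fin.ne_zero_of_lt hab) (w.injective (Fin.ext h')).symm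
        rcases Fin.eq_zero_or_eq_succ a with rfl | ⟨a', rfl⟩
        · omega
        · have := (hw 0 a'.succ b (Fin.succ_pos _) hab (Nat.zero_le _) (Nat.zero_le _)
            (Nat.zero_le _)).2
          simp only [Fin.lt_def] at this
          omega

/-- Each nonempty avoider has exactly two extensions. The empty one has a single extension, so the
doubling starts only at `t 3 1`. -/
lemma t_add_four_one (m : ℕ) : t (m + 4) 1 = 2 * t (m + 3) 1 := by
  classical
  rw [t_add_two_one (m + 2), t_add_two_one (m + 1), card_filter_eq_sum_prepend,
    Finset.card_filter, Finset.mul_sum]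
  refine Finset.sum_congr rfl fun w _ => ?_
  by_cases hw : UpperAvoids w 0
  · simp only [upperAvoids_prepend_zero_iff hw, hw, if_true, mul_one]
    have : ({j | j = Fin.last (m + 1) ∨ j = (w 0).castSucc} : Finset (Fin (m + 2))) =
        {Fin.last (m + 1), (w 0).castSucc} := by
      ext j; simp
    rw [this, Finset.card_pair (Fin.castSucc_lt_last _).ne']
  · have : ∀ j, ¬ UpperAvoids (prepend j w) 0 := fun j h =>
      hw ((upperAvoids_prepend_iff (Nat.zero_le _)).1 h).1
    simp [this, hw]

lemma t_two_one : t 2 1 = 1 := by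
  classical
  rw [t_add_two_one 0, Finset.card_filter]
  simp [UpperAvoids]

lemma t_add_three_one (k : ℕ) : t (k + 3) 1 = 2 ^ k := by
  induction k with
  | zero =>
    classical
    rw [t_add_two_one 1, Finset.card_filter]
    simp [UpperAvoids]
  | succ k ih => rw [t_add_four_one, ih, pow_succ, mul_comm]

/-! ### Closed form of the entries -/

lemma t_add_three_two (k : ℕ) : t (k + 3) 2 = t (k + 2) 1 + t (k + 2) 2 := by
  rw [t_add_three (c := 1) le_rfl (by omega), Finset.sum_range_succ, Finset.sum_range_one]

/-- Difference of two consecutive partial sums; `t_add_three` needs `1 ≤ c`, so this starts in the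
third column. -/
lemma t_add_three_add_three {k b : ℕ} (h : b + 1 ≤ k) :
    t (k + 3) (b + 3) = t (k + 3) (b + 2) + t (k + 2) (b + 3) := by
  rw [t_add_three (c := b + 2) (by omega) (by omega), Finset.sum_range_succ,
    t_add_three (c := b + 1) (by omega) (by omega)]

-- Induction on the column, then on the row. The inductive step is Pascal's rule; the base `a = b`
-- of each column uses that the entry above it lies outside the triangle and vanishes.
open Finset in
lemma t_eq_sum_choose (a b : ℕ) (h : b ≤ a) :
    t (a + 3) (b + 2) = ∑ i ∈ Ico b (a + 1), (a + b).choose i := by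
  induction b generalizing a with
  | zero =>
    rw [add_zero, Nat.Ico_zero_eq_range, Nat.sum_range_choose, zero_add]
    clear h
    induction a with
    | zero => rw [t_add_three_two, t_two_one, t_eq_zero le_rfl]; rfl
    | succ a ih => rw [t_add_three_two, t_add_three_one, ih, pow_succ, mul_two]
  | succ b ihb =>
    induction a, h using Nat.le_induction with
    | base =>
      rw [t_add_three_add_three le_rfl, ihb _ (by omega), t_eq_zero (by omega)]
      rw [sum_Ico_succ_top (by omega), Nat.Ico_succ_singleton, Nat.Ico_succ_singleton,
        sum_singleton, sum_singleton, add_zero,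
        show b + 1 + (b + 1) = (b + 1 + b) + 1 by ring, Nat.choose_succ_succ]
    | succ a ha iha =>
      rw [t_add_three_add_three (by omega), ihb _ (by omega), iha,
        sum_eq_sum_Ico_succ_bot (by omega : b < a + 1 + 1)]
      have e1 : ∑ i ∈ Ico (b + 1) (a + 1 + 1), (a + 1 + (b + 1)).choose i =
          ∑ i ∈ Ico b (a + 1), ((a + 1 + b).choose i + (a + 1 + b).choose (i + 1)) := by
        rw [← sum_Ico_add' _ b (a + 1) 1]
        refine sum_congr rfl fun i _ => ?_
        rw [show a + 1 + (b + 1) = (a + 1 + b) + 1 by ring, Nat.choose_succ_succ]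
      have e2 : ∑ i ∈ Ico (b + 1) (a + 1 + 1), (a + 1 + b).choose i =
          ∑ i ∈ Ico b (a + 1), (a + 1 + b).choose (i + 1) :=
        (sum_Ico_add' (fun i => (a + 1 + b).choose i) b (a + 1) 1).symm
      rw [e1, sum_add_distrib, e2,
        sum_eq_sum_Ico_succ_bot (by omega : b < a + 1) fun i => (a + 1 + b).choose i,
        show a + (b + 1) = a + 1 + b by ring]
      ring

lemma t_add_three_add_two (N : ℕ) : t (N + 3) (N + 2) = (2 * N).choose N := by
  rw [t_eq_sum_choose N N le_rfl, Nat.Ico_succ_singleton, Finset.sum_singleton, two_mul]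

lemma ncard_adjacentAvoiders_eq_choose (N : ℕ) :
    (adjacentAvoiders (N + 2)).ncard = (2 * N).choose N := by
  rw [ncard_adjacentAvoiders_eq_t, t_add_three_add_two]

lemma sum_Icc_t (N : ℕ) :
    ∑ ℓ ∈ Finset.Icc 1 (N + 1), t (N + 2) ℓ = (adjacentAvoiders (N + 2)).ncard := by
  rw [ncard_adjacentAvoiders, ← Finset.Ico_succ_right_eq_Icc, Finset.sum_Ico_eq_sum_range]
  simp [add_comm]

/-! ### The central binomial series -/

/-- The generating function of the central binomial coefficients. -/
noncomputable def centralBinomSeries : ℚ⟦X⟧ := PowerSeries.mk fun n => ((2 * n).choose n : ℚ)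

/-- The recurrence of the central binomial coefficients says `(1 - 4X) f' = 2 f`, so `f ^ 2 * (1 -
4X)` has derivative zero and equals its constant term. -/
lemma centralBinomSeries_sq_mul : centralBinomSeries ^ 2 * (1 - 4 * PowerSeries.X) = 1 := by
  have h4 : (4 : ℚ⟦X⟧) = PowerSeries.C 4 := (map_ofNat PowerSeries.C 4).symm
  have ode : (1 - 4 * PowerSeries.X) * PowerSeries.derivative ℚ centralBinomSeries =
      2 * centralBinomSeries := by
    have h2 : (2 : ℚ⟦X⟧) = PowerSeries.C 2 := (map_ofNat PowerSeries.C 2).symm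
    rw [sub_mul, one_mul, mul_assoc, h4, h2]
    ext n
    have hrec : ∀ m : ℕ, ((m : ℚ) + 1) * ((2 * (m + 1)).choose (m + 1) : ℚ) =
        2 * (2 * m + 1) * ((2 * m).choose m : ℚ) := by
      intro m
      have := Nat.succ_mul_centralBinom_succ m
      simp only [Nat.centralBinom] at this
      exact_mod_cast this
    rcases n with _ | n
    · rw [map_sub, PowerSeries.coeff_C_mul, PowerSeries.coeff_C_mul,
        PowerSeries.coeff_zero_X_mul, PowerSeries.coeff_derivative]
      simp [centralBinomSeries]
    · have := hrec (n + 1)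
      rw [map_sub, PowerSeries.coeff_C_mul, PowerSeries.coeff_C_mul,
        PowerSeries.coeff_succ_X_mul, PowerSeries.coeff_derivative, PowerSeries.coeff_derivative]
      simp only [centralBinomSeries, PowerSeries.coeff_mk]
      push_cast at this ⊢
      linear_combination this
  refine PowerSeries.derivative.ext ?_ ?_
  · have hd4 : PowerSeries.derivative ℚ (4 : ℚ⟦X⟧) = 0 := by rw [h4, PowerSeries.derivative_C]
    rw [Derivation.leibniz, Derivation.leibniz_pow, map_sub, Derivation.leibniz, hd4]
    simp only [PowerSeries.derivative_X, Derivation.map_one_eq_zero, smul_eq_mul, nsmul_eq_mul]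
    push_cast
    linear_combination (2 * centralBinomSeries) * ode
  · simp [centralBinomSeries]

/-! ### The bivariate generating function -/

/-- The bivariate power series with coefficient `f a b` at `x ^ a * u ^ b`. -/
def series (f : ℕ → ℕ → ℚ) : MvPowerSeries (Fin 2) ℚ := fun e => f (e 0) (e 1)

lemma coeff_series (f : ℕ → ℕ → ℚ) (e : Fin 2 →₀ ℕ) :
    MvPowerSeries.coeff e (series f) = f (e 0) (e 1) := rfl

lemma x_mul_series (f : ℕ → ℕ → ℚ) :
    x * series f = series fun a b => if a = 0 then 0 else f (a - 1) b := by
  ext e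
  rw [x, MvPowerSeries.X, MvPowerSeries.coeff_monomial_mul, one_mul, coeff_series, coeff_series]
  simp only [Finsupp.single_le_iff, Nat.one_le_iff_ne_zero, Finsupp.tsub_apply]
  split_ifs <;> simp_all

lemma u_mul_series (f : ℕ → ℕ → ℚ) :
    u * series f = series fun a b => if b = 0 then 0 else f a (b - 1) := by
  ext e
  rw [u, MvPowerSeries.X, MvPowerSeries.coeff_monomial_mul, one_mul, coeff_series, coeff_series]
  simp only [Finsupp.single_le_iff, Nat.one_le_iff_ne_zero, Finsupp.tsub_apply]
  split_ifs <;> simp_all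

lemma series_sub (f h : ℕ → ℕ → ℚ) :
    series f - series h = series fun a b => f a b - h a b := rfl

lemma series_add (f h : ℕ → ℕ → ℚ) :
    series f + series h = series fun a b => f a b + h a b := rfl

lemma one_eq_series : (1 : MvPowerSeries (Fin 2) ℚ) =
    series fun a b => if a = 0 ∧ b = 0 then 1 else 0 := by
  ext e
  rw [MvPowerSeries.coeff_one, coeff_series]
  simp [Finsupp.ext_iff, Fin.forall_fin_two]

lemma coeff_rowPoly (n ℓ : ℕ) :
    (rowPoly n).coeff ℓ = if 1 ≤ ℓ ∧ ℓ + 1 ≤ n then (t n ℓ : ℚ) else 0 := by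
  simp only [rowPoly, Polynomial.finsetSum_coeff, Polynomial.coeff_C_mul_X_pow,
    Finset.sum_ite_eq, Finset.mem_Icc]
  congr 1
  simp only [eq_iff_iff]
  omega

lemma g_eq_series : g = series fun n ℓ => if 1 ≤ ℓ ∧ ℓ + 1 ≤ n then (t n ℓ : ℚ) else 0 := by
  funext e
  exact coeff_rowPoly _ _

lemma hasSubst_u_mul_x : PowerSeries.HasSubst (u * x) :=
  PowerSeries.HasSubst.of_constantCoeff_zero (by simp [u, x])

/-- The reciprocal of the square root of `1 - 4ux`. -/
noncomputable def diagonalSeries : MvPowerSeries (Fin 2) ℚ :=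
  PowerSeries.subst (u * x) centralBinomSeries

lemma diagonalSeries_sq_mul : diagonalSeries ^ 2 * (1 - 4 * u * x) = 1 := by
  have h := congrArg (PowerSeries.substAlgHom (R := ℚ) hasSubst_u_mul_x) centralBinomSeries_sq_mul
  rw [map_mul, map_pow, map_sub, map_mul, map_one, map_ofNat, PowerSeries.substAlgHom_X,
    PowerSeries.coe_substAlgHom] at h
  rw [diagonalSeries, mul_assoc 4]
  exact h

lemma diagonalSeries_eq : diagonalSeries =
    series fun a b => if a = b then ((2 * a).choose a : ℚ) else 0 := by
  ext e
  have hpow : ∀ d, MvPowerSeries.coeff e ((u * x) ^ d) = if e 0 = d ∧ e 1 = d then 1 else 0 := by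
    intro d
    rw [mul_pow, u, x, MvPowerSeries.X_pow_eq, MvPowerSeries.X_pow_eq,
      MvPowerSeries.monomial_mul_monomial, MvPowerSeries.coeff_monomial]
    simp [Finsupp.ext_iff, Fin.forall_fin_two]
  rw [diagonalSeries, PowerSeries.coeff_subst hasSubst_u_mul_x, finsum_eq_single _ (e 0)]
  · rw [hpow, coeff_series]
    simp [centralBinomSeries, eq_comm]
  · intro d hd
    rw [hpow, if_neg fun h => hd h.1.symm, smul_zero]

/-- The coefficients of `(1 - x) ^ 2 / (1 - 2 * x)`. -/
def firstColumn : ℕ → ℚ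
  | 0 => 1
  | 1 => 0
  | n + 2 => 2 ^ n

lemma series_firstColumn_mul :
    series (fun a b => if b = 0 then firstColumn a else 0) * (1 - 2 * x) = (1 - x) ^ 2 := by
  set K := series (fun a b => if b = 0 then firstColumn a else 0) with hK
  have h : K - (x * K + x * K) = 1 - (x * 1 + x * 1) + x * (x * 1) := by
    rw [hK, one_eq_series]
    simp only [x_mul_series, series_sub, series_add]
    congr 1
    funext a b
    rcases a with _ | _ | _ | a <;> rcases b with _ | b <;> simp [firstColumn]
    · ring
  linear_combination h

/-- Just past the end of a row (`N = k`) the Pascal-type rule would predict the last entry of the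
row where there is `0`; this defect is the central binomial coefficient. -/
lemma t_recurrence (N k : ℕ) :
    ((if k < N then (t (N + 3) (k + 3) : ℚ) else 0) -
      (if k ≤ N then (t (N + 3) (k + 2) : ℚ) else 0) -
      if k + 1 < N then (t (N + 2) (k + 3) : ℚ) else 0) =
    - if N = k then ((2 * N).choose N : ℚ) else 0 := by
  rcases lt_trichotomy N k with h | rfl | h
  · rw [if_neg (by omega), if_neg (by omega), if_neg (by omega), if_neg (by omega)]
    simp
  · rw [if_neg (by omega), if_pos (by omega), if_neg (by omega), if_pos rfl,
      t_add_three_add_two]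
    simp
  · rw [if_pos (by omega), if_pos (by omega), if_neg h.ne', t_add_three_add_three h]
    split_ifs with h'
    · push_cast; ring
    · rw [t_eq_zero (n := N) (by omega)]; simp

/-- Comparison of coefficients. At `u ^ 1` the left side gives the differences of the first column,
which are the shifted `firstColumn`; at `u ^ 2` it gives their negatives, whence the factor `u * (1
- u)`. From `u ^ 3` on only the diagonal defect remains. -/
lemma mul_g : (1 - u - x) * g =
    u * (1 - u) * x ^ 2 * series (fun a b => if b = 0 then firstColumn a else 0) -
      u ^ 3 * x ^ 3 * diagonalSeries := by
  set K := series (fun a b => if b = 0 then firstColumn a else 0) with hK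
  have h : g - u * g - x * g = u * (x * (x * K)) - u * (u * (x * (x * K))) -
      u * (u * (u * (x * (x * (x * diagonalSeries))))) := by
    rw [hK, g_eq_series, diagonalSeries_eq]
    simp only [x_mul_series, u_mul_series, series_sub]
    congr 1
    funext a b
    rcases b with _ | _ | _ | k
    · simp
    · rcases a with _ | _ | _ | _ | N
      · simp
      · simp
      · simp [firstColumn, t_two_one]
      · simp [firstColumn, t_two_one, t_add_three_one 0]
      · simp [firstColumn, t_add_three_one N, t_add_three_one (N + 1)]
        ring
    · rcases a with _ | _ | _ | _ | N
      · simp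
      · simp
      · simp [firstColumn, t_two_one]
      · simp [firstColumn, t_two_one, t_add_three_two 0, t_add_three_one 0, t_eq_zero]
      · simp [firstColumn, t_add_three_two (N + 1), t_add_three_one N, t_add_three_one (N + 1)]
        ring
    · rcases a with _ | _ | _ | N
      · simp
      · simp
      · simp
      · simp
        exact t_recurrence N k
  linear_combination h

/-! ### Specialization at `u = 1` -/

lemma gAtOne_eq : gAtOne = PowerSeries.mk fun n : ℕ =>
    if 2 ≤ n then (Nat.choose (2 * (n - 2)) (n - 2) : ℚ) else 0 := by
  ext n
  rw [gAtOne, PowerSeries.coeff_mk, PowerSeries.coeff_mk, rowPoly, Polynomial.eval_finsetSum]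
  simp only [Polynomial.eval_mul, Polynomial.eval_C, Polynomial.eval_pow, Polynomial.eval_X,
    one_pow, mul_one]
  rcases n with _ | _ | N
  · simp
  · simp
  · rw [if_pos (by omega), ← Nat.cast_sum, show N + 1 + 1 - 1 = N + 1 from rfl, sum_Icc_t,
      ncard_adjacentAvoiders_eq_choose, show N + 1 + 1 - 2 = N from rfl]

lemma gAtOne_eq_X_sq_mul : gAtOne = PowerSeries.X ^ 2 * centralBinomSeries := by
  rw [gAtOne_eq]
  ext n
  rw [PowerSeries.coeff_X_pow_mul', PowerSeries.coeff_mk, centralBinomSeries,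
    PowerSeries.coeff_mk]

end PatternAvoid

theorem mainTheorem9 :
    (∃ R : MvPowerSeries (Fin 2) ℚ,
      -- `R` is the formal square root of `1 - 4ux` with constant term `1`
      (MvPowerSeries.constantCoeff R = 1 ∧ R ^ 2 = 1 - 4 * PatternAvoid.u * PatternAvoid.x) ∧
      PatternAvoid.g =
        (1 - PatternAvoid.u - PatternAvoid.x)⁻¹ *
          (PatternAvoid.u * (1 - PatternAvoid.u) * PatternAvoid.x ^ 2 * (1 - PatternAvoid.x) ^ 2 *
              (1 - 2 * PatternAvoid.x)⁻¹ -
            PatternAvoid.u ^ 3 * PatternAvoid.x ^ 3 * R⁻¹)) ∧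
    (∃ r : PowerSeries ℚ,
      -- `r` is the formal square root of `1 - 4x` with constant term `1`
      (PowerSeries.constantCoeff r = 1 ∧ r ^ 2 = 1 - 4 * PowerSeries.X) ∧
      PatternAvoid.gAtOne = PowerSeries.X ^ 2 * r⁻¹) ∧
    PatternAvoid.gAtOne =
      PowerSeries.mk (fun n : ℕ =>
        if 2 ≤ n then (Nat.choose (2 * (n - 2)) (n - 2) : ℚ) else 0) ∧
    (∀ n : ℕ, 2 ≤ n →
      ∑ ℓ ∈ Finset.Icc 1 (n - 1), PatternAvoid.t n ℓ = (PatternAvoid.adjacentAvoiders n).ncard ∧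
      (PatternAvoid.adjacentAvoiders n).ncard = Nat.choose (2 * (n - 2)) (n - 2)) := by
  -- With `D ^ 2 * (1 - 4ux) = 1`, the series `(1 - 4ux) * D` squares to `1 - 4ux` and has inverse
  -- `D`; likewise in one variable.
  refine ⟨⟨(1 - 4 * PatternAvoid.u * PatternAvoid.x) * PatternAvoid.diagonalSeries, ⟨?_, ?_⟩, ?_⟩,
    ⟨(1 - 4 * PowerSeries.X) * PatternAvoid.centralBinomSeries, ⟨?_, ?_⟩, ?_⟩,
    PatternAvoid.gAtOne_eq, fun n hn => ?_⟩
  · rw [map_mul, PatternAvoid.diagonalSeries_eq,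
      ← MvPowerSeries.coeff_zero_eq_constantCoeff_apply (PatternAvoid.series _),
      PatternAvoid.coeff_series]
    simp [PatternAvoid.u, PatternAvoid.x]
  · linear_combination
      (1 - 4 * PatternAvoid.u * PatternAvoid.x) * PatternAvoid.diagonalSeries_sq_mul
  · have hR : ((1 - 4 * PatternAvoid.u * PatternAvoid.x) * PatternAvoid.diagonalSeries)⁻¹ =
        PatternAvoid.diagonalSeries := by
      rw [eq_comm, MvPowerSeries.eq_inv_iff_mul_eq_one]
      · linear_combination PatternAvoid.diagonalSeries_sq_mul
      · intro h0
        have := congrArg MvPowerSeries.constantCoeff PatternAvoid.diagonalSeries_sq_mul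
        rw [pow_two, mul_assoc, map_mul, mul_comm PatternAvoid.diagonalSeries, h0] at this
        simp at this
    have hK : (1 - PatternAvoid.x) ^ 2 * (1 - 2 * PatternAvoid.x)⁻¹ =
        PatternAvoid.series
          (fun a b => if b = 0 then PatternAvoid.firstColumn a else 0) := by
      rw [eq_comm, MvPowerSeries.eq_mul_inv_iff_mul_eq (by simp [PatternAvoid.x]),
        PatternAvoid.series_firstColumn_mul]
    rw [hR, mul_comm (1 - PatternAvoid.u - PatternAvoid.x)⁻¹,
      MvPowerSeries.eq_mul_inv_iff_mul_eq (by simp [PatternAvoid.u, PatternAvoid.x]),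
      mul_assoc _ _ (1 - 2 * PatternAvoid.x)⁻¹, hK, mul_comm, PatternAvoid.mul_g]
  · simp [PatternAvoid.centralBinomSeries]
  · linear_combination (1 - 4 * PowerSeries.X) * PatternAvoid.centralBinomSeries_sq_mul
  · have hr : ((1 - 4 * PowerSeries.X) * PatternAvoid.centralBinomSeries)⁻¹ =
        PatternAvoid.centralBinomSeries := by
      rw [eq_comm, PowerSeries.eq_inv_iff_mul_eq_one]
      · linear_combination PatternAvoid.centralBinomSeries_sq_mul
      · simp [PatternAvoid.centralBinomSeries]
    rw [hr, PatternAvoid.gAtOne_eq_X_sq_mul]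
  · obtain ⟨N, rfl⟩ := Nat.exists_eq_add_of_le' hn
    exact ⟨PatternAvoid.sum_Icc_t N, PatternAvoid.ncard_adjacentAvoiders_eq_choose N⟩
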